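/- Let $\mathbb{T}\subseteq\mathbb{R}$ be a time scale (a nonempty closed set) with forward jump operator $\sigma$, let $a,b\in\mathbb{T}$ with $a<b$, and write $[a,b]=\{t\in\mathbb{T}: a\le t\le b\}$, itself regarded as a time scale. Let $\nu:[a,b]\to(0,\infty)$ be continuous, let $w:[a,b]\to\mathbb{R}$ be delta differentiable with $w^\Delta=\nu$, let $p,q:[a,b]\to\mathbb{R}$ be delta differentiable, let $\psi:[0,1]\to[0,1]$ be any function and let $\lambda\in[0,1]$. (A delta derivative on $[a,b]$ is taken in the time scale $[a,b]$, at every point except $b$ when $b$ is left-scattered.) Suppose that $$P=\sup_{t\in\mathbb{T},\ a\le t<b}|p^\Delta(t)|<\infty,\qquad Q=\sup_{t\in\mathbb{T},\ a\le t<b}|q^\Delta(t)|<\infty,$$ and put $$K(s,t)=\begin{cases} w(s)-\Big(w(a)+\psi(\lambda)\frac{w(b)-w(a)}{2}\Big), & s\in[a,t),\\[2pt] w(s)-\Big(w(a)+(1+\psi(1-\lambda))\frac{w(b)-w(a)}{2}\Big), & s\in[t,b].\end{cases}$$ The delta integral $\int_a^b f(t)\,\Delta t$ is $F(b)-F(a)$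 for any pre-antiderivative $F$ of $f$ on $[a,b]$, that is, a continuous $F$ with $F^\Delta=f$ (at the points where delta derivatives are taken) outside a countable set that contains no right-scattered point of $[a,b]$. Then all delta integrals below exist, and $$\begin{aligned} \Bigg|&\big(1+\psi(1-\lambda)-\psi(\lambda)\big)\Big(\int_a^b\nu(t)\Delta t\Big)\Big(\int_a^b p(t)q(t)\Delta t\Big)\\ &+\frac{\psi(\lambda)p(a)+(1-\psi(1-\lambda))p(b)}{2}\Big(\int_a^b\nu(t)\Delta t\Big)\Big(\int_a^b q(t)\Delta t\Big)\\ &+\frac{\psi(\lambda)q(a)+(1-\psi(1-\lambda))q(b)}{2}\Big(\int_a^b\nu(t)\Delta t\Big)\Big(\int_a^b p(t)\Delta t\Big)\\ &-\int_a^b q(t)\Big(\int_a^b\nu(s)p(\sigma(s))\Delta s\Big)\Delta t-\int_a^b p(t)\Big(\int_a^b\nu(s)q(\sigma(s))\Delta s\Big)\Delta t\Bigg|\\ &\le\int_a^b\big(P|q(t)|+Q|p(t)|\big)\Big(\int_a^b|K(s,t)|\,\Delta s\Big)\Delta t . \end{aligned}$$ -/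

import Mathlib

open Set Topology

noncomputable section

/-- A time scale: a nonempty closed subset of the real line. -/
structure IsTimeScale (T : Set ℝ) : Prop where
  nonempty : T.Nonempty
  isClosed : IsClosed T

/-- The forward jump operator `inf {s ∈ T : s > t}`, with the usual convention `inf ∅ = sup T`
(so a maximum of `T` is mapped to itself). -/
def forwardJump (T : Set ℝ) (t : ℝ) : ℝ :=
  open Classical in if (T ∩ Ioi t).Nonempty then sInf (T ∩ Ioi t) else t

/-- The backward jump operator `sup {s ∈ T : s < t}`, with the usual convention `sup ∅ = inf T`
(so a minimum of `T` is mapped to itself). -/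
def backwardJump (T : Set ℝ) (t : ℝ) : ℝ :=
  open Classical in if (T ∩ Iio t).Nonempty then sSup (T ∩ Iio t) else t

/-- The part of a time scale on which delta derivatives are taken: `T` without its maximum if
`T` has a left-scattered maximum, and `T` otherwise. -/
def timeScaleKappa (T : Set ℝ) : Set ℝ :=
  {t | t ∈ T ∧ ¬ (IsGreatest T t ∧ backwardJump T t < t)}

/-- `f` has the delta derivative `d` at `t` with respect to the time scale `T`. Only the values
of `f` on `T` matter. -/
def HasDeltaDerivAt (T : Set ℝ) (f : ℝ → ℝ) (d t : ℝ) : Prop :=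
  ∀ ε > 0, ∃ U ∈ 𝓝 t, ∀ s ∈ U ∩ T,
    |f (forwardJump T t) - f s - d * (forwardJump T t - s)| ≤ ε * |forwardJump T t - s|

/-- `f` is delta differentiable at every point where a delta derivative can be taken. -/
def DeltaDifferentiable (T : Set ℝ) (f : ℝ → ℝ) : Prop :=
  ∀ t ∈ timeScaleKappa T, ∃ d, HasDeltaDerivAt T f d t

/-- The delta derivative of `f` at `t` (`0` if there is none; it is unique on
`timeScaleKappa T`). -/
def deltaDeriv (T : Set ℝ) (f : ℝ → ℝ) (t : ℝ) : ℝ :=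
  open Classical in if h : ∃ d, HasDeltaDerivAt T f d t then h.choose else 0

/-- `F` is a pre-antiderivative of `f` on the time scale `T`: it is continuous, and it has delta
derivative `f t` at every `t` outside a countable exceptional set which contains no
right-scattered point. With an empty exceptional set this is an antiderivative; the exceptional
set admits integrands with jumps at dense points, as in the Cauchy delta integral of a
regulated function. -/
def IsDeltaPreAntideriv (T : Set ℝ) (F f : ℝ → ℝ) : Prop :=
  ContinuousOn F T ∧ ∃ D ⊆ timeScaleKappa T, (timeScaleKappa T \ D).Countable ∧
    (∀ t ∈ timeScaleKappa T \ D, forwardJump T t = t) ∧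
    ∀ t ∈ D, HasDeltaDerivAt T F (f t) t

/-- The delta integral of `f` from `a` to `b` exists: `f` has a pre-antiderivative on the
time scale interval `[a, b] = {t ∈ T : a ≤ t ≤ b}`. -/
def DeltaIntegrable (T : Set ℝ) (a b : ℝ) (f : ℝ → ℝ) : Prop :=
  ∃ F, IsDeltaPreAntideriv (T ∩ Icc a b) F f

/-- The (Cauchy) delta integral from `a` to `b`: the increment `F b - F a` of a pre-antiderivative
`F` (any two of them differ by a constant); `0` if there is none. -/
def deltaIntegral (T : Set ℝ) (a b : ℝ) (f : ℝ → ℝ) : ℝ :=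
  open Classical in if h : DeltaIntegrable T a b f then h.choose b - h.choose a else 0

/-- The weighted Peano kernel `K(s, t)`. -/
def weightedKernel (w ψ : ℝ → ℝ) (lam a b s t : ℝ) : ℝ :=
  open Classical in
  if s < t then w s - (w a + ψ lam * ((w b - w a) / 2))
  else w s - (w a + (1 + ψ (1 - lam)) * ((w b - w a) / 2))

end

/-!
Everything takes place on the compact time scale `S = [a, b]`, where a pre-antiderivative is a
continuous function with prescribed increments at right-scattered points and an ordinary derivative
at right-dense points off a countable set (`IsCompactTimeScale.isDeltaPreAntideriv_iff`). This form
makes linearity, the product rule and concatenation at a point (`IsDeltaPreAntideriv.glue`)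
immediate.

Two facts carry the integral calculus. The integral is monotone, hence well defined
(`IsDeltaPreAntideriv.increment_le`), because a function with positive delta derivative off a
countable set of right-dense points cannot decrease. And bounded functions that are continuous at
right-dense points off a countable set are integrable (`IsCompactTimeScale.exists_preAntideriv`),
by Lebesgue integration of their extension that is constant on the gaps of `S`.

For the inequality, integration by parts on `[a, t)` and `[t, b]` gives the Montgomery identity
`∫ K(s, t) p^Δ(s) Δs = (c₂ - c₁) p(t) + (c₁ - w(a)) p(a) + (w(b) - c₂) p(b) - ∫ ν p^σ`, where `c₁`
and `c₂` are the constants in the two branches of the kernel. Hence its right-hand side is at most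
`P ∫ |K(s, t)| Δs` in absolute value (`IsCompactTimeScale.montgomery_le`). Multiplying this
identity by `q(t)`, the one for `q` by `p(t)`, adding and integrating in `t` yields the theorem.
Here `∫ |K(s, t)| Δs` is a continuous function of `t`, since concatenation expresses it through
antiderivatives of `|w - c₁|` and `|w - c₂|`.
-/

/-- `S` is a compact time scale with minimum `a` and maximum `b`, having more than one point. -/
structure IsCompactTimeScale (S : Set ℝ) (a b : ℝ) : Prop where
  isClosed : IsClosed S
  isLeast : IsLeast S a
  isGreatest : IsGreatest S b
  lt : a < b

/-! ### The forward jump operator and delta derivatives -/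

section Jump

variable {S : Set ℝ} {a b t s : ℝ}

theorem le_forwardJump (S : Set ℝ) (t : ℝ) : t ≤ forwardJump S t := by
  unfold forwardJump
  split_ifs with h
  · exact le_csInf h fun x hx => hx.2.le
  · exact le_rfl

theorem forwardJump_le (hs : s ∈ S) (hts : t < s) : forwardJump S t ≤ s := by
  have h : (S ∩ Ioi t).Nonempty := ⟨s, hs, hts⟩
  rw [forwardJump, if_pos h]
  exact csInf_le ⟨t, fun x hx => hx.2.le⟩ ⟨hs, hts⟩

namespace IsCompactTimeScale

theorem isCompact (hS : IsCompactTimeScale S a b) : IsCompact S :=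
  isCompact_Icc.of_isClosed_subset hS.isClosed
    fun _ hx => ⟨hS.isLeast.2 hx, hS.isGreatest.2 hx⟩

theorem forwardJump_mem (hS : IsCompactTimeScale S a b) (ht : t ∈ S) : forwardJump S t ∈ S := by
  unfold forwardJump
  split_ifs with h
  · have hbdd : BddBelow (S ∩ Ioi t) := ⟨t, fun x hx => hx.2.le⟩
    have := csInf_mem_closure h hbdd
    exact hS.isClosed.closure_subset_iff.2 inter_subset_left this
  · exact ht

theorem forwardJump_max (hS : IsCompactTimeScale S a b) : forwardJump S b = b := by
  rw [forwardJump, if_neg]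
  rintro ⟨x, hx, hbx⟩
  exact absurd (hS.isGreatest.2 hx) (not_le.2 hbx)

theorem lt_max_of_lt_forwardJump (hS : IsCompactTimeScale S a b) (ht : t ∈ S)
    (h : t < forwardJump S t) : t < b :=
  h.trans_le (hS.isGreatest.2 (hS.forwardJump_mem ht))

/-- A right-dense point other than the maximum is a limit of larger points. -/
theorem exists_mem_Ioo (hS : IsCompactTimeScale S a b) (htb : t < b)
    (hd : forwardJump S t = t) {c : ℝ} (hc : t < c) : ∃ s ∈ S, t < s ∧ s < c := by
  have h : (S ∩ Ioi t).Nonempty := ⟨b, hS.isGreatest.1, htb⟩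
  rw [forwardJump, if_pos h] at hd
  obtain ⟨s, hs, hsc⟩ := exists_lt_of_csInf_lt h (hd.symm ▸ hc)
  exact ⟨s, hs.1, hs.2, hsc⟩

theorem mem_kappa_of_lt (hS : IsCompactTimeScale S a b) (ht : t ∈ S) (htb : t < b) :
    t ∈ timeScaleKappa S :=
  ⟨ht, fun h => absurd (h.1.2 hS.isGreatest.1) (not_le.2 htb)⟩

/-- The forward jump operator is continuous at right-dense points. -/
theorem continuousWithinAt_forwardJump (hS : IsCompactTimeScale S a b) (htb : t < b)
    (hd : forwardJump S t = t) : ContinuousWithinAt (forwardJump S) S t := by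
  rw [Metric.continuousWithinAt_iff]
  intro ε hε
  obtain ⟨u, hu, htu, huε⟩ := hS.exists_mem_Ioo htb hd (lt_add_of_pos_right t hε)
  refine ⟨min ε (u - t), lt_min hε (sub_pos.2 htu), fun x hx hxt => ?_⟩
  rw [Real.dist_eq, lt_min_iff, abs_lt, abs_lt] at hxt
  rw [hd, Real.dist_eq, abs_lt]
  have h1 := le_forwardJump S x
  have h2 : forwardJump S x ≤ u := forwardJump_le hu (by linarith [hxt.2.2])
  constructor <;> linarith [hxt.1.1]

end IsCompactTimeScale

variable {F : ℝ → ℝ} {d : ℝ}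

theorem HasDeltaDerivAt.increment (h : HasDeltaDerivAt S F d t) (ht : t ∈ S) :
    F (forwardJump S t) - F t = d * (forwardJump S t - t) := by
  have key : |F (forwardJump S t) - F t - d * (forwardJump S t - t)| ≤ 0 := by
    refine le_of_forall_pos_le_add fun ε hε => ?_
    obtain ⟨U, hU, hUS⟩ := h (ε / (|forwardJump S t - t| + 1)) (by positivity)
    refine (hUS t ⟨mem_of_mem_nhds hU, ht⟩).trans ?_
    rw [zero_add, div_mul_eq_mul_div, div_le_iff₀ (by positivity)]
    nlinarith [abs_nonneg (forwardJump S t - t)]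
  linarith [abs_nonpos_iff.1 key]

theorem hasDeltaDerivAt_iff_of_dense (hd : forwardJump S t = t) :
    HasDeltaDerivAt S F d t ↔ HasDerivWithinAt F d S t := by
  rw [hasDerivWithinAt_iff_isLittleO, Asymptotics.isLittleO_iff]
  unfold HasDeltaDerivAt
  simp only [hd]
  refine forall₂_congr fun ε _ => ?_
  rw [eventually_nhdsWithin_iff, Filter.eventually_iff_exists_mem]
  refine exists_congr fun U => and_congr_right fun _ => ?_
  constructor
  · intro h s hs hsS
    have := h s ⟨hs, hsS⟩
    rw [abs_sub_comm t s] at this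
    simp only [Real.norm_eq_abs, smul_eq_mul]
    rwa [← abs_neg, show -(F s - F t - (s - t) * d) = F t - F s - d * (t - s) by ring]
  · intro h s hs
    have := h s hs.1 hs.2
    simp only [Real.norm_eq_abs, smul_eq_mul] at this
    rw [abs_sub_comm t s]
    rwa [← abs_neg, show -(F t - F s - d * (t - s)) = F s - F t - (s - t) * d by ring]

theorem hasDeltaDerivAt_of_scattered (hsc : t < forwardJump S t) (hF : ContinuousWithinAt F S t)
    (hinc : F (forwardJump S t) - F t = d * (forwardJump S t - t)) : HasDeltaDerivAt S F d t := by
  intro ε hε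
  have hc : ContinuousWithinAt
      (fun s => |F (forwardJump S t) - F s - d * (forwardJump S t - s)|
        - ε * |forwardJump S t - s|) S t := by fun_prop
  have hneg : |F (forwardJump S t) - F t - d * (forwardJump S t - t)|
        - ε * |forwardJump S t - t| < 0 := by
    rw [hinc, sub_self, abs_zero, zero_sub, neg_lt_zero]
    exact mul_pos hε (abs_pos.2 (sub_pos.2 hsc).ne')
  have hev := hc.eventually_lt_const hneg
  rw [eventually_nhdsWithin_iff, Filter.eventually_iff_exists_mem] at hev
  obtain ⟨U, hU, h⟩ := hev
  exact ⟨U, hU, fun s hs => by linarith [h s hs.1 hs.2]⟩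

theorem HasDeltaDerivAt.continuousWithinAt (h : HasDeltaDerivAt S F d t) (ht : t ∈ S) :
    ContinuousWithinAt F S t := by
  have hinc := h.increment ht
  rw [Metric.continuousWithinAt_iff]
  intro ε hε
  set m := forwardJump S t - t with hm
  -- The bound below is `|F s - F t| ≤ |d| |s - t| + η |σ t - s|` with `|σ t - s| ≤ |m| + 1`.
  obtain ⟨U, hU, hUS⟩ := h (ε / (2 * (|m| + 1))) (by positivity)
  obtain ⟨δ, hδ, hball⟩ := Metric.mem_nhds_iff.1 hU
  refine ⟨min δ (min 1 (ε / (2 * (|d| + 1)))), by positivity, fun s hs hst => ?_⟩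
  rw [lt_min_iff, lt_min_iff] at hst
  have h1 := hUS s ⟨hball hst.1, hs⟩
  have hst1 := hst.2.1
  have hst2 := hst.2.2
  rw [Real.dist_eq] at hst1 hst2 ⊢
  have h2 : |forwardJump S t - s| ≤ |m| + 1 := by
    have : forwardJump S t - s = m - (s - t) := by rw [hm]; ring
    rw [this]
    exact (abs_sub _ _).trans (by linarith)
  have h3 : ε / (2 * (|m| + 1)) * |forwardJump S t - s| ≤ ε / 2 := by
    calc _ ≤ ε / (2 * (|m| + 1)) * (|m| + 1) := by gcongr
      _ = ε / 2 := by field_simp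
  have h4 : |d * (s - t)| < ε / 2 := by
    rw [lt_div_iff₀ (by positivity)] at hst2
    rw [abs_mul]
    nlinarith [abs_nonneg (s - t), abs_nonneg d]
  have h5 : F s - F t = d * (s - t) - (F (forwardJump S t) - F s - d * (forwardJump S t - s)) := by
    have : forwardJump S t - s = m - (s - t) := by rw [hm]; ring
    rw [this]; linarith
  rw [h5]
  exact (abs_sub _ _).trans_lt (by linarith)

end Jump

/-! ### Pre-antiderivatives -/

section PreAntideriv

variable {S : Set ℝ} {a b t : ℝ} {F G f g : ℝ → ℝ}

/-- On a compact time scale, being a pre-antiderivative splits into an exact increment condition at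
right-scattered points and an ordinary one-variable derivative at right-dense points off a countable
set. The maximum may always be put into the exceptional set. -/
theorem IsCompactTimeScale.isDeltaPreAntideriv_iff (hS : IsCompactTimeScale S a b) :
    IsDeltaPreAntideriv S F f ↔ ContinuousOn F S ∧
      (∀ t ∈ S, F (forwardJump S t) - F t = f t * (forwardJump S t - t)) ∧
      ∃ E : Set ℝ, E.Countable ∧ ∀ t ∈ S, t ∉ E → t < b → forwardJump S t = t →
        HasDerivWithinAt F (f t) S t := by
  constructor
  · rintro ⟨hF, D, hD, hcount, hdense, hder⟩
    refine ⟨hF, fun t ht => ?_, timeScaleKappa S \ D, hcount, fun t ht htE htb htd => ?_⟩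
    · rcases (le_forwardJump S t).eq_or_lt with h | h
      · simp [← h]
      · have htκ := hS.mem_kappa_of_lt ht (hS.lt_max_of_lt_forwardJump ht h)
        by_cases htD : t ∈ D
        · exact (hder t htD).increment ht
        · exact absurd (hdense t ⟨htκ, htD⟩) h.ne'
    · have htκ := hS.mem_kappa_of_lt ht htb
      have htD : t ∈ D := by
        by_contra h
        exact htE ⟨htκ, h⟩
      exact (hasDeltaDerivAt_iff_of_dense htd).1 (hder t htD)
  · rintro ⟨hF, hinc, E, hE, hder⟩
    refine ⟨hF, {t ∈ timeScaleKappa S | t < forwardJump S t ∨ (t ∉ E ∧ t < b)},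
      fun t ht => ht.1, ?_, ?_, ?_⟩
    · refine (hE.insert b).mono fun t ht => ?_
      by_contra hcon
      rw [mem_insert_iff, not_or] at hcon
      exact ht.2 ⟨ht.1, Or.inr ⟨hcon.2, lt_of_le_of_ne (hS.isGreatest.2 ht.1.1) hcon.1⟩⟩
    · intro t ht
      by_contra hcon
      exact ht.2 ⟨ht.1, Or.inl (lt_of_le_of_ne (le_forwardJump S t) (Ne.symm hcon))⟩
    · intro t ht
      rcases (le_forwardJump S t).eq_or_lt with h | h
      · obtain h' | h' := ht.2
        · exact absurd h h'.ne
        · exact (hasDeltaDerivAt_iff_of_dense h.symm).2 (hder t ht.1.1 h'.1 h'.2 h.symm)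
      · exact hasDeltaDerivAt_of_scattered h (hF t ht.1.1) (hinc t ht.1.1)

namespace IsDeltaPreAntideriv

theorem congr (hF : IsDeltaPreAntideriv S F f) (hS : IsCompactTimeScale S a b)
    (hfg : ∀ t ∈ S, t < b → f t = g t) : IsDeltaPreAntideriv S F g := by
  rw [hS.isDeltaPreAntideriv_iff] at hF ⊢
  obtain ⟨hc, hinc, E, hE, hder⟩ := hF
  refine ⟨hc, fun t ht => ?_, E, hE, fun t ht htE htb htd => hfg t ht htb ▸ hder t ht htE htb htd⟩
  rcases (hS.isGreatest.2 ht).eq_or_lt with h | h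
  · subst h; simp [hS.forwardJump_max]
  · rw [hinc t ht, hfg t ht h]

theorem add (hF : IsDeltaPreAntideriv S F f) (hG : IsDeltaPreAntideriv S G g)
    (hS : IsCompactTimeScale S a b) :
    IsDeltaPreAntideriv S (fun t => F t + G t) (fun t => f t + g t) := by
  rw [hS.isDeltaPreAntideriv_iff] at *
  obtain ⟨hc, hinc, E, hE, hder⟩ := hF
  obtain ⟨hc', hinc', E', hE', hder'⟩ := hG
  refine ⟨hc.add hc', fun t ht => by linarith [hinc t ht, hinc' t ht], E ∪ E', hE.union hE',
    fun t ht htE htb htd => ?_⟩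
  rw [mem_union, not_or] at htE
  exact (hder t ht htE.1 htb htd).add (hder' t ht htE.2 htb htd)

theorem const_mul (hF : IsDeltaPreAntideriv S F f) (hS : IsCompactTimeScale S a b) (c : ℝ) :
    IsDeltaPreAntideriv S (fun t => c * F t) (fun t => c * f t) := by
  rw [hS.isDeltaPreAntideriv_iff] at *
  obtain ⟨hc, hinc, E, hE, hder⟩ := hF
  refine ⟨hc.const_mul c, fun t ht => ?_, E, hE,
    fun t ht htE htb htd => (hder t ht htE htb htd).const_mul c⟩
  rw [mul_assoc, ← hinc t ht, mul_sub]

theorem sub (hF : IsDeltaPreAntideriv S F f) (hG : IsDeltaPreAntideriv S G g)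
    (hS : IsCompactTimeScale S a b) :
    IsDeltaPreAntideriv S (fun t => F t - G t) (fun t => f t - g t) := by
  simpa [sub_eq_add_neg] using hF.add (hG.const_mul hS (-1)) hS

theorem sub_const (hF : IsDeltaPreAntideriv S F f) (hS : IsCompactTimeScale S a b) (c : ℝ) :
    IsDeltaPreAntideriv S (fun t => F t - c) f := by
  rw [hS.isDeltaPreAntideriv_iff] at *
  obtain ⟨hc, hinc, E, hE, hder⟩ := hF
  refine ⟨hc.sub continuousOn_const, fun t ht => by linarith [hinc t ht], E, hE,
    fun t ht htE htb htd => (hder t ht htE htb htd).sub_const c⟩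

/-- The product rule `(FG)^Δ = F G^Δ + F^Δ G^σ`, for pre-antiderivatives. -/
theorem mul (hF : IsDeltaPreAntideriv S F f) (hG : IsDeltaPreAntideriv S G g)
    (hS : IsCompactTimeScale S a b) :
    IsDeltaPreAntideriv S (fun t => F t * G t)
      (fun t => F t * g t + f t * G (forwardJump S t)) := by
  rw [hS.isDeltaPreAntideriv_iff] at *
  obtain ⟨hc, hinc, E, hE, hder⟩ := hF
  obtain ⟨hc', hinc', E', hE', hder'⟩ := hG
  refine ⟨hc.mul hc', fun t ht => ?_, E ∪ E', hE.union hE', fun t ht htE htb htd => ?_⟩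
  · linear_combination F t * hinc' t ht + G (forwardJump S t) * hinc t ht
  · rw [mem_union, not_or] at htE
    have := (hder t ht htE.1 htb htd).mul (hder' t ht htE.2 htb htd)
    rw [htd, add_comm]
    exact this

/-- Pre-antiderivatives can be concatenated at a point `c`, shifting the second one by a constant;
if `c` is right-dense it joins the exceptional set. -/
theorem glue (hF : IsDeltaPreAntideriv S F f) (hG : IsDeltaPreAntideriv S G g)
    (hS : IsCompactTimeScale S a b) {c : ℝ} (hc : c ∈ S) :
    IsDeltaPreAntideriv S (fun t => if t < c then F t else G t - G c + F c)
      (fun t => if t < c then f t else g t) := by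
  rw [hS.isDeltaPreAntideriv_iff] at *
  obtain ⟨hFc, hFinc, E, hE, hder⟩ := hF
  obtain ⟨hGc, hGinc, E', hE', hder'⟩ := hG
  refine ⟨?_, fun t ht => ?_, insert c (E ∪ E'), (hE.union hE').insert c,
    fun t ht htE htb htd => ?_⟩
  · refine ContinuousOn.if ?_ (hFc.mono inter_subset_left)
      (((hGc.sub continuousOn_const).add continuousOn_const).mono inter_subset_left)
    intro t ht
    have : t = c := by simpa using frontier_lt_subset_eq continuous_id continuous_const ht.2
    simp [this]
  · by_cases htc : t < c
    · have hle := forwardJump_le hc htc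
      rw [if_pos htc, if_pos htc, ← hFinc t ht]
      rcases hle.eq_or_lt with h | h
      · simp [h]
      · rw [if_pos h]
    · have : ¬ forwardJump S t < c := not_lt.2 ((not_lt.1 htc).trans (le_forwardJump S t))
      rw [if_neg htc, if_neg htc, if_neg this, ← hGinc t ht]
      ring
  · simp only [mem_insert_iff, mem_union, not_or] at htE
    rcases lt_or_gt_of_ne htE.1 with h | h
    · rw [if_pos h]
      refine (hder t ht htE.2.1 htb htd).congr_of_eventuallyEq ?_ (if_pos h)
      filter_upwards [mem_nhdsWithin_of_mem_nhds (Iio_mem_nhds h)] with x hx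
      exact if_pos hx
    · rw [if_neg h.not_gt]
      refine (((hder' t ht htE.2.2 htb htd).sub_const (G c)).add_const (F c)).congr_of_eventuallyEq
        ?_ (if_neg h.not_gt)
      filter_upwards [mem_nhdsWithin_of_mem_nhds (Ioi_mem_nhds h)] with x hx
      exact if_neg (not_lt.2 (le_of_lt hx))

end IsDeltaPreAntideriv

/-- A function with positive delta derivative off a countable set of right-dense points does not
decrease: otherwise some level `c` strictly between `F b` and `F a` is missed on the exceptional
set, and the last point where `F ≥ c` violates the sign of the derivative. -/
theorem IsDeltaPreAntideriv.le_of_pos (hF : IsDeltaPreAntideriv S F f)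
    (hS : IsCompactTimeScale S a b) (hf : ∀ t ∈ S, t < b → 0 < f t) : F a ≤ F b := by
  rw [hS.isDeltaPreAntideriv_iff] at hF
  obtain ⟨hc, hinc, E, hE, hder⟩ := hF
  by_contra! hlt
  obtain ⟨c, hc1, hcE⟩ : ∃ c ∈ Ioo (F b) (F a), c ∉ F '' E := by
    by_contra! hcon
    exact (Cardinal.Real.Ioo_countable_iff.not.2 (not_le.2 hlt))
      ((hE.image F).mono hcon)
  let A : Set ℝ := S ∩ F ⁻¹' Ici c
  have hAclosed : IsClosed A := hc.preimage_isClosed_of_isClosed hS.isClosed isClosed_Ici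
  have hAne : A.Nonempty := ⟨a, hS.isLeast.1, hc1.2.le⟩
  have hAbdd : BddAbove A := ⟨b, fun x hx => hS.isGreatest.2 hx.1⟩
  set t := sSup A
  have htA : t ∈ A := hAclosed.csSup_mem hAne hAbdd
  have hgt : ∀ s ∈ S, t < s → F s < c := fun s hs hts => by
    by_contra! h
    exact absurd (le_csSup hAbdd ⟨hs, h⟩) (not_le.2 hts)
  have htb : t < b := by
    refine lt_of_le_of_ne (hS.isGreatest.2 htA.1) fun h => ?_
    have : c ≤ F t := htA.2
    rw [h] at this
    exact absurd this (not_le.2 hc1.1)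
  have hFt : c ≤ F t := htA.2
  rcases (le_forwardJump S t).eq_or_lt with hd | hd
  · have hnb : Filter.NeBot (𝓝[S ∩ Ioi t] t) := by
      rw [← mem_closure_iff_nhdsWithin_neBot, Metric.mem_closure_iff]
      intro ε hε
      obtain ⟨s, hs, hts, hsε⟩ := hS.exists_mem_Ioo htb hd.symm (lt_add_of_pos_right t hε)
      refine ⟨s, ⟨hs, hts⟩, ?_⟩
      rw [Real.dist_eq, abs_lt]
      constructor <;> linarith
    have hFle : F t ≤ c := by
      refine le_of_tendsto ((hc t htA.1).mono_left (nhdsWithin_mono t (inter_subset_left (t := Ioi t)))) ?_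
      filter_upwards [self_mem_nhdsWithin] with s hs using (hgt s hs.1 hs.2).le
    have htE : t ∉ E := fun h => hcE ⟨t, h, le_antisymm hFle hFt⟩
    have hD := (hder t htA.1 htE htb hd.symm).mono (inter_subset_left (t := Ioi t))
    have hslope := (hasDerivWithinAt_iff_tendsto_slope' (fun h => lt_irrefl t h.2)).1 hD
    have hev := hslope.eventually_const_lt (hf t htA.1 htb)
    obtain ⟨s, hs, hsS⟩ := (hev.and self_mem_nhdsWithin).exists
    have hpos := (slope_pos_iff_of_le hsS.2.le).1 hs
    linarith [hgt s hsS.1 hsS.2]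
  · have h1 := hinc t htA.1
    have h2 := hgt _ (hS.forwardJump_mem htA.1) hd
    have h3 := mul_pos (hf t htA.1 htb) (sub_pos.2 hd)
    linarith

theorem isDeltaPreAntideriv_id (hS : IsCompactTimeScale S a b) :
    IsDeltaPreAntideriv S (fun t => t) (fun _ => 1) :=
  hS.isDeltaPreAntideriv_iff.2 ⟨continuousOn_id, fun t _ => by simp, ∅, countable_empty,
    fun t _ _ _ _ => hasDerivWithinAt_id t S⟩

/-- Monotonicity of the delta integral, in terms of pre-antiderivatives. -/
theorem IsDeltaPreAntideriv.increment_le (hF : IsDeltaPreAntideriv S F f)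
    (hG : IsDeltaPreAntideriv S G g) (hS : IsCompactTimeScale S a b)
    (hfg : ∀ t ∈ S, t < b → f t ≤ g t) : F b - F a ≤ G b - G a := by
  refine le_of_forall_pos_le_add fun ε hε => ?_
  have hba := sub_pos.2 hS.lt
  have hη : 0 < ε / (b - a) := div_pos hε hba
  have h := ((hG.sub hF hS).add ((isDeltaPreAntideriv_id hS).const_mul hS (ε / (b - a)))
    hS).le_of_pos hS (fun t ht htb => by linarith [hfg t ht htb])
  have : ε / (b - a) * b - ε / (b - a) * a = ε := by field_simp
  linarith

theorem IsDeltaPreAntideriv.abs_increment_le (hF : IsDeltaPreAntideriv S F f)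
    (hG : IsDeltaPreAntideriv S G g) (hS : IsCompactTimeScale S a b)
    (hfg : ∀ t ∈ S, t < b → |f t| ≤ g t) : |F b - F a| ≤ G b - G a := by
  rw [abs_le]
  have h1 := hF.increment_le hG hS fun t ht htb => (le_abs_self _).trans (hfg t ht htb)
  have h2 := (hF.const_mul hS (-1)).increment_le hG hS fun t ht htb => by
    linarith [neg_abs_le (f t), hfg t ht htb]
  constructor <;> linarith

end PreAntideriv

theorem IsDeltaPreAntideriv.deltaIntegral_eq {T : Set ℝ} {a b : ℝ} {F f : ℝ → ℝ}
    (hF : IsDeltaPreAntideriv (T ∩ Icc a b) F f)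
    (hS : IsCompactTimeScale (T ∩ Icc a b) a b) : deltaIntegral T a b f = F b - F a := by
  have h : DeltaIntegrable T a b f := ⟨F, hF⟩
  rw [deltaIntegral, dif_pos h]
  exact le_antisymm (h.choose_spec.increment_le hF hS fun _ _ _ => le_rfl)
    (hF.increment_le h.choose_spec hS fun _ _ _ => le_rfl)

/-! ### Existence of delta integrals -/

section Existence

variable {S : Set ℝ} {a b t : ℝ} {f : ℝ → ℝ}

theorem countable_rightScattered (S : Set ℝ) : {t ∈ S | t < forwardJump S t}.Countable := by
  refine Set.PairwiseDisjoint.countable_of_Ioo (y := forwardJump S) ?_ fun t ht => ht.2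
  have key : ∀ s ∈ S, ∀ t ∈ S, s < t →
      Disjoint (Ioo s (forwardJump S s)) (Ioo t (forwardJump S t)) := fun s _ t ht hst =>
    disjoint_left.2 fun x hx hx' => lt_irrefl x
      (hx.2.trans_le ((forwardJump_le ht hst).trans hx'.1.le))
  intro s hs t ht hst
  rcases lt_or_gt_of_ne hst with h | h
  · exact key s hs.1 t ht.1 h
  · exact (key t ht.1 s hs.1 h).symm

/-- The largest point of `S` not exceeding `x`, for `x ≥ a`; smaller `x` are first moved up to `a`,
which makes the function monotone on the whole line. -/
noncomputable def lastPoint (S : Set ℝ) (a x : ℝ) : ℝ := sSup (S ∩ Iic (max a x))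

namespace IsCompactTimeScale

theorem isGreatest_lastPoint (hS : IsCompactTimeScale S a b) (x : ℝ) :
    IsGreatest (S ∩ Iic (max a x)) (lastPoint S a x) := by
  have hne : (S ∩ Iic (max a x)).Nonempty := ⟨a, hS.isLeast.1, mem_Iic.2 (le_max_left _ _)⟩
  have hbdd : BddAbove (S ∩ Iic (max a x)) := ⟨b, fun _ hy => hS.isGreatest.2 hy.1⟩
  exact ⟨(hS.isClosed.inter isClosed_Iic).csSup_mem hne hbdd, fun _ hy => le_csSup hbdd hy⟩

theorem monotone_lastPoint (hS : IsCompactTimeScale S a b) : Monotone (lastPoint S a) :=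
  fun x y hxy => (hS.isGreatest_lastPoint y).2
    ⟨(hS.isGreatest_lastPoint x).1.1,
      le_trans (hS.isGreatest_lastPoint x).1.2 (max_le_max_left a hxy)⟩

theorem le_lastPoint (hS : IsCompactTimeScale S a b) (ht : t ∈ S) {x : ℝ} (htx : t ≤ x) :
    t ≤ lastPoint S a x :=
  (hS.isGreatest_lastPoint x).2 ⟨ht, htx.trans (le_max_right _ _)⟩

theorem lastPoint_le (hS : IsCompactTimeScale S a b) {x : ℝ} (hx : a ≤ x) :
    lastPoint S a x ≤ x := by
  simpa [max_eq_right hx] using (hS.isGreatest_lastPoint x).1.2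

theorem lastPoint_eq (hS : IsCompactTimeScale S a b) (ht : t ∈ S) {x : ℝ} (htx : t ≤ x)
    (hx : x < forwardJump S t) : lastPoint S a x = t := by
  refine le_antisymm ?_ (hS.le_lastPoint ht htx)
  by_contra! h
  have h1 := forwardJump_le (hS.isGreatest_lastPoint x).1.1 h
  have h2 := hS.lastPoint_le ((hS.isLeast.2 ht).trans htx)
  linarith

/-- A bounded function that is continuous at the right-dense points off a countable set has a
pre-antiderivative: the Lebesgue integral of the function made constant on each gap. -/
theorem exists_preAntideriv (hS : IsCompactTimeScale S a b) {M : ℝ} (hM : ∀ t ∈ S, |f t| ≤ M)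
    {E : Set ℝ} (hE : E.Countable)
    (hf : ∀ t ∈ S, t ∉ E → t < b → forwardJump S t = t → ContinuousWithinAt f S t) :
    ∃ F, IsDeltaPreAntideriv S F f := by
  have hmem : ∀ x, lastPoint S a x ∈ S := fun x => (hS.isGreatest_lastPoint x).1.1
  -- Off a countable set `C`, the function `f` is continuous on `S`, so its extension by zero is
  -- measurable.
  set C : Set ℝ := insert b (E ∪ {t ∈ S | t < forwardJump S t}) with hC_def
  have hC : C.Countable := (hE.union (countable_rightScattered S)).insert b
  have hcont : ContinuousOn f (S \ C) := by
    intro t ht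
    have htC := ht.2
    simp only [hC_def, mem_insert_iff, mem_union, mem_ofPred_eq, not_or, not_and, not_lt] at htC
    exact (hf t ht.1 htC.2.1 (lt_of_le_of_ne (hS.isGreatest.2 ht.1) htC.1)
      (le_antisymm (htC.2.2 ht.1) (le_forwardJump S t))).mono sdiff_subset
  have hSC : MeasurableSet (S \ C) := hS.isClosed.measurableSet.diff hC.measurableSet
  have hind : Measurable ((S \ C).indicator f) := by
    classical
    rw [← piecewise_eq_indicator]
    exact hcont.measurable_piecewise continuousOn_const hSC
  have hind' : Measurable (S.indicator f) := by
    refine hind.measurable_of_countable_ne (hC.mono fun x hx => ?_)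
    by_contra hxC
    refine hx ?_
    by_cases hxS : x ∈ S <;> simp [indicator, hxS, hxC]
  set g : ℝ → ℝ := fun x => f (lastPoint S a x) with hg_def
  have hg : Measurable g := by
    have : g = S.indicator f ∘ lastPoint S a := by
      ext x
      simp [hg_def, hmem x]
    rw [this]
    exact hind'.comp hS.monotone_lastPoint.measurable
  have hint : ∀ u v, IntervalIntegrable g MeasureTheory.volume u v := fun u v =>
    (intervalIntegrable_const (c := M)).mono_fun hg.aestronglyMeasurable
      (Filter.Eventually.of_forall fun x => by
        simpa using (hM _ (hmem x)).trans (le_abs_self M))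
  have hsub : ∀ u v, (∫ x in a..v, g x) - (∫ x in a..u, g x) = ∫ x in u..v, g x := fun u v =>
    intervalIntegral.integral_interval_sub_left (hint a v) (hint a u)
  refine ⟨fun t => ∫ x in a..t, g x, hS.isDeltaPreAntideriv_iff.2
    ⟨(intervalIntegral.continuous_primitive hint a).continuousOn, fun t ht => ?_, E, hE,
      fun t ht htE htb htd => ?_⟩⟩
  · rw [hsub, intervalIntegral.integral_congr_Ioo_of_le (g := fun _ => f t) (le_forwardJump S t)
      fun x hx => ?_]
    · simp [mul_comm]
    · simp only [hg_def, hS.lastPoint_eq ht hx.1.le hx.2]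
  · -- Between `t` and a point `s ∈ S`, the integrand takes only values of `f` at points of `S`
    -- between `t` and `s`.
    rw [hasDerivWithinAt_iff_isLittleO, Asymptotics.isLittleO_iff]
    intro ε hε
    obtain ⟨δ, hδ, hball⟩ := Metric.continuousWithinAt_iff.1 (hf t ht htE htb htd) ε hε
    filter_upwards [self_mem_nhdsWithin, mem_nhdsWithin_of_mem_nhds (Metric.ball_mem_nhds t hδ)]
      with s hs hst
    have hconst : (s - t) • f t = ∫ _ in t..s, f t := by simp
    rw [hsub, hconst, ← intervalIntegral.integral_sub (hint t s) intervalIntegrable_const,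
      Real.norm_eq_abs (s - t)]
    refine intervalIntegral.norm_integral_le_of_norm_le_const fun x hx => ?_
    have hx' := hball (hmem x) ?_
    · rw [Real.dist_eq] at hx'
      exact hx'.le
    · have hax : a ≤ x := (le_min (hS.isLeast.2 ht) (hS.isLeast.2 hs)).trans hx.1.le
      have h1 := hS.lastPoint_le hax
      rw [Metric.mem_ball, Real.dist_eq, abs_lt] at hst
      rw [Real.dist_eq, abs_lt]
      rcases le_total t s with h | h
      · rw [uIoc_of_le h] at hx
        have h2 := hS.le_lastPoint ht hx.1.le
        constructor <;> linarith [hx.2]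
      · rw [uIoc_of_ge h] at hx
        have h2 := hS.le_lastPoint hs hx.1.le
        constructor <;> linarith [hx.2]

theorem exists_preAntideriv_of_continuousOn (hS : IsCompactTimeScale S a b)
    (hf : ContinuousOn f S) : ∃ F, IsDeltaPreAntideriv S F f := by
  obtain ⟨M, hM⟩ := hS.isCompact.exists_bound_of_continuousOn hf
  exact hS.exists_preAntideriv hM countable_empty fun t ht _ _ _ => hf t ht

theorem exists_preAntideriv_mul_comp_forwardJump (hS : IsCompactTimeScale S a b) {g : ℝ → ℝ}
    (hf : ContinuousOn f S) (hg : ContinuousOn g S) :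
    ∃ F, IsDeltaPreAntideriv S F (fun t => f t * g (forwardJump S t)) := by
  obtain ⟨M, hM⟩ := hS.isCompact.exists_bound_of_continuousOn hf
  obtain ⟨N, hN⟩ := hS.isCompact.exists_bound_of_continuousOn hg
  refine hS.exists_preAntideriv (M := M * N) (fun t ht => ?_) countable_empty
    fun t ht _ htb htd => (hf t ht).mul ?_
  · rw [abs_mul]
    exact mul_le_mul (hM t ht) (hN _ (hS.forwardJump_mem ht)) (abs_nonneg _)
      ((abs_nonneg _).trans (hM t ht))
  · refine ContinuousWithinAt.comp (t := S) (by rw [htd]; exact hg t ht)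
      (hS.continuousWithinAt_forwardJump htb htd) fun s hs => hS.forwardJump_mem hs

end IsCompactTimeScale

/-- A delta differentiable function is continuous; at a left-scattered maximum, where no derivative
is taken, because that point is isolated. -/
theorem continuousOn_of_hasDeltaDerivAt {d : ℝ → ℝ}
    (hf : ∀ t ∈ timeScaleKappa S, HasDeltaDerivAt S f (d t) t) : ContinuousOn f S := by
  intro t ht
  by_cases htκ : t ∈ timeScaleKappa S
  · exact (hf t htκ).continuousWithinAt ht
  · have hmax : IsGreatest S t ∧ backwardJump S t < t := by
      by_contra h
      exact htκ ⟨ht, h⟩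
    have hne : (S ∩ Iio t).Nonempty := by
      by_contra h
      have := hmax.2
      rw [backwardJump, if_neg h] at this
      exact lt_irrefl t this
    have heq : ({t} : Set ℝ) =ᶠ[𝓝 t] S := by
      rw [Filter.eventuallyEq_set]
      filter_upwards [Ioi_mem_nhds hmax.2] with x hx
      refine ⟨fun h => ?_, fun hxS => ?_⟩
      · rw [mem_singleton_iff.1 h]; exact ht
      · refine mem_singleton_iff.2 ((hmax.1.2 hxS).eq_of_not_lt fun hxt => ?_)
        rw [mem_Ioi, backwardJump, if_pos hne] at hx
        have hbdd : BddAbove (S ∩ Iio t) := ⟨t, fun y hy => le_of_lt hy.2⟩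
        exact absurd (le_csSup hbdd ⟨hxS, hxt⟩) (not_le.2 hx)
    exact (continuousWithinAt_congr_set heq).1 continuousWithinAt_singleton

theorem isDeltaPreAntideriv_of_hasDeltaDerivAt {F : ℝ → ℝ}
    (hF : ∀ t ∈ timeScaleKappa S, HasDeltaDerivAt S F (f t) t) : IsDeltaPreAntideriv S F f :=
  ⟨continuousOn_of_hasDeltaDerivAt hF, timeScaleKappa S, subset_rfl, by simp, by simp, hF⟩

theorem DeltaDifferentiable.isDeltaPreAntideriv {F : ℝ → ℝ}
    (hF : DeltaDifferentiable S F) : IsDeltaPreAntideriv S F (deltaDeriv S F) :=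
  isDeltaPreAntideriv_of_hasDeltaDerivAt fun t ht => by
    rw [deltaDeriv, dif_pos (hF t ht)]
    exact (hF t ht).choose_spec

end Existence

theorem IsTimeScale.isCompactTimeScale {T : Set ℝ} (hT : IsTimeScale T) {a b : ℝ} (ha : a ∈ T)
    (hb : b ∈ T) (hab : a < b) : IsCompactTimeScale (T ∩ Icc a b) a b where
  isClosed := hT.isClosed.inter isClosed_Icc
  isLeast := ⟨⟨ha, le_rfl, hab.le⟩, fun _ hx => hx.2.1⟩
  isGreatest := ⟨⟨hb, hab.le, le_rfl⟩, fun _ hx => hx.2.2⟩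
  lt := hab

/-- Below `b`, the forward jump operators of `T` and of `[a, b]` agree. At `b` they differ when `b`
is right-scattered in `T`. -/
theorem forwardJump_inter_Icc {T : Set ℝ} {a b t : ℝ} (hb : b ∈ T) (hat : a ≤ t) (htb : t < b) :
    forwardJump (T ∩ Icc a b) t = forwardJump T t := by
  have hbI : b ∈ T ∩ Icc a b := ⟨hb, hat.trans htb.le, le_rfl⟩
  have h1 : (T ∩ Icc a b ∩ Ioi t).Nonempty := ⟨b, hbI, htb⟩
  have h2 : (T ∩ Ioi t).Nonempty := ⟨b, hb, htb⟩
  apply le_antisymm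
  · rw [forwardJump.eq_def T, if_pos h2]
    refine le_csInf h2 fun x hx => ?_
    rcases le_total x b with h | h
    · exact forwardJump_le ⟨hx.1, hat.trans (le_of_lt hx.2), h⟩ hx.2
    · exact (forwardJump_le hbI htb).trans h
  · rw [forwardJump.eq_def (T ∩ Icc a b), if_pos h1]
    exact le_csInf h1 fun x hx => forwardJump_le hx.1.1 hx.2

/-! ### The Montgomery estimate -/

section Montgomery

variable {S : Set ℝ} {a b : ℝ}

theorem IsCompactTimeScale.glue_increment (hS : IsCompactTimeScale S a b) (F G : ℝ → ℝ) {c : ℝ}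
    (hc : c ∈ S) :
    (if b < c then F b else G b - G c + F c) - (if a < c then F a else G a - G c + F c) =
      F c - F a + (G b - G c) := by
  rw [if_neg (not_lt.2 (hS.isGreatest.2 hc))]
  rcases (hS.isLeast.2 hc).eq_or_lt with h | h
  · subst h; simp
  · rw [if_pos h]; ring

/-- Montgomery identity with the integral of `K p^Δ` estimated by `P ∫ |K|`, where `K` is `w - c₁`
to the left of `t` and `w - c₂` from `t` on. No integrability of `K p^Δ` has to be assumed: the
concatenation at `t` of `(w - c₁) p - N` and `(w - c₂) p - N` is a pre-antiderivative. -/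
theorem IsCompactTimeScale.montgomery_le (hS : IsCompactTimeScale S a b)
    {w ν p p' N A₁ A₂ : ℝ → ℝ} {c₁ c₂ P : ℝ} (hw : IsDeltaPreAntideriv S w ν)
    (hp : IsDeltaPreAntideriv S p p')
    (hN : IsDeltaPreAntideriv S N (fun s => ν s * p (forwardJump S s)))
    (hA₁ : IsDeltaPreAntideriv S A₁ (fun s => |w s - c₁|))
    (hA₂ : IsDeltaPreAntideriv S A₂ (fun s => |w s - c₂|))
    (hP : ∀ s ∈ S, s < b → |p' s| ≤ P) {t : ℝ} (ht : t ∈ S) :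
    |(c₂ - c₁) * p t + (c₁ - w a) * p a + (w b - c₂) * p b - (N b - N a)| ≤
      P * (A₁ t - A₁ a + (A₂ b - A₂ t)) := by
  have hpiece : ∀ c, IsDeltaPreAntideriv S (fun s => (w s - c) * p s - N s)
      (fun s => (w s - c) * p' s) := fun c =>
    (((hw.sub_const hS c).mul hp hS).sub hN hS).congr hS fun s _ _ => by ring
  have hL := (hpiece c₁).glue (hpiece c₂) hS ht
  have hR := (hA₁.glue hA₂ hS ht).const_mul hS P
  have h := hL.abs_increment_le hR hS fun s hs hsb => by
    have := hP s hs hsb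
    split_ifs <;> rw [abs_mul, mul_comm] <;> gcongr
  simp only [← mul_sub] at h
  rw [hS.glue_increment A₁ A₂ ht, hS.glue_increment (fun s => (w s - c₁) * p s - N s)
    (fun s => (w s - c₂) * p s - N s) ht] at h
  convert h using 2
  ring

end Montgomery

/-! ### The inequality -/

theorem theorem3p8 (T : Set ℝ) (hT : IsTimeScale T) (a b : ℝ) (ha : a ∈ T) (hb : b ∈ T)
    (hab : a < b) (ν w p q ψ : ℝ → ℝ) (lam P Q : ℝ)
    (hν : ContinuousOn ν (T ∩ Icc a b)) (hν_pos : ∀ t ∈ T ∩ Icc a b, 0 < ν t)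
    (hw : ∀ t ∈ timeScaleKappa (T ∩ Icc a b), HasDeltaDerivAt (T ∩ Icc a b) w (ν t) t)
    (hp : DeltaDifferentiable (T ∩ Icc a b) p) (hq : DeltaDifferentiable (T ∩ Icc a b) q)
    (hψ : MapsTo ψ (Icc 0 1) (Icc 0 1)) (hlam : lam ∈ Icc (0 : ℝ) 1)
    (hP : IsLUB ((fun t => |deltaDeriv (T ∩ Icc a b) p t|) '' (T ∩ Ico a b)) P)
    (hQ : IsLUB ((fun t => |deltaDeriv (T ∩ Icc a b) q t|) '' (T ∩ Ico a b)) Q) :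
    (DeltaIntegrable T a b ν ∧ DeltaIntegrable T a b p ∧ DeltaIntegrable T a b q ∧
      DeltaIntegrable T a b (fun t => p t * q t) ∧
      DeltaIntegrable T a b (fun s => ν s * p (forwardJump T s)) ∧
      DeltaIntegrable T a b (fun s => ν s * q (forwardJump T s)) ∧
      DeltaIntegrable T a b
        (fun t => q t * deltaIntegral T a b (fun s => ν s * p (forwardJump T s))) ∧
      DeltaIntegrable T a b
        (fun t => p t * deltaIntegral T a b (fun s => ν s * q (forwardJump T s))) ∧
      (∀ t ∈ T ∩ Icc a b, DeltaIntegrable T a b (fun s => |weightedKernel w ψ lam a b s t|)) ∧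
      DeltaIntegrable T a b (fun t => (P * |q t| + Q * |p t|) *
        deltaIntegral T a b (fun s => |weightedKernel w ψ lam a b s t|))) ∧
    |(1 + ψ (1 - lam) - ψ lam) * deltaIntegral T a b ν * deltaIntegral T a b (fun t => p t * q t)
      + (ψ lam * p a + (1 - ψ (1 - lam)) * p b) / 2
          * deltaIntegral T a b ν * deltaIntegral T a b q
      + (ψ lam * q a + (1 - ψ (1 - lam)) * q b) / 2
          * deltaIntegral T a b ν * deltaIntegral T a b p
      - deltaIntegral T a b
          (fun t => q t * deltaIntegral T a b (fun s => ν s * p (forwardJump T s)))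
      - deltaIntegral T a b
          (fun t => p t * deltaIntegral T a b (fun s => ν s * q (forwardJump T s)))|
    ≤ deltaIntegral T a b (fun t => (P * |q t| + Q * |p t|) *
        deltaIntegral T a b (fun s => |weightedKernel w ψ lam a b s t|)) := by
  have hS := hT.isCompactTimeScale ha hb hab
  have hwν := isDeltaPreAntideriv_of_hasDeltaDerivAt hw
  have hpd := hp.isDeltaPreAntideriv
  have hqd := hq.isDeltaPreAntideriv
  have hwc := hwν.1
  have hpc := hpd.1
  have hqc := hqd.1
  have hP' : ∀ s ∈ T ∩ Icc a b, s < b → |deltaDeriv (T ∩ Icc a b) p s| ≤ P := fun s hs hsb =>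
    hP.1 ⟨s, ⟨hs.1, hs.2.1, hsb⟩, rfl⟩
  have hQ' : ∀ s ∈ T ∩ Icc a b, s < b → |deltaDeriv (T ∩ Icc a b) q s| ≤ Q := fun s hs hsb =>
    hQ.1 ⟨s, ⟨hs.1, hs.2.1, hsb⟩, rfl⟩
  obtain ⟨Ip, hIp⟩ := hS.exists_preAntideriv_of_continuousOn hpc
  obtain ⟨Iq, hIq⟩ := hS.exists_preAntideriv_of_continuousOn hqc
  obtain ⟨Ipq, hIpq⟩ := hS.exists_preAntideriv_of_continuousOn
    (f := fun t => p t * q t) (hpc.mul hqc)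
  obtain ⟨Np, hNp⟩ := hS.exists_preAntideriv_mul_comp_forwardJump hν hpc
  obtain ⟨Nq, hNq⟩ := hS.exists_preAntideriv_mul_comp_forwardJump hν hqc
  have hjump : ∀ s ∈ T ∩ Icc a b, s < b → forwardJump (T ∩ Icc a b) s = forwardJump T s :=
    fun s hs hsb => forwardJump_inter_Icc hb hs.2.1 hsb
  have hNp' : IsDeltaPreAntideriv (T ∩ Icc a b) Np (fun s => ν s * p (forwardJump T s)) :=
    hNp.congr hS fun s hs hsb => by rw [hjump s hs hsb]
  have hNq' : IsDeltaPreAntideriv (T ∩ Icc a b) Nq (fun s => ν s * q (forwardJump T s)) :=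
    hNq.congr hS fun s hs hsb => by rw [hjump s hs hsb]
  set c₁ := w a + ψ lam * ((w b - w a) / 2) with hc₁
  set c₂ := w a + (1 + ψ (1 - lam)) * ((w b - w a) / 2) with hc₂
  obtain ⟨A₁, hA₁⟩ := hS.exists_preAntideriv_of_continuousOn
    (f := fun s => |w s - c₁|) (hwc.sub continuousOn_const).abs
  obtain ⟨A₂, hA₂⟩ := hS.exists_preAntideriv_of_continuousOn
    (f := fun s => |w s - c₂|) (hwc.sub continuousOn_const).abs
  have hK : ∀ t ∈ T ∩ Icc a b, IsDeltaPreAntideriv (T ∩ Icc a b)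
      (fun s => if s < t then A₁ s else A₂ s - A₂ t + A₁ t)
      (fun s => |weightedKernel w ψ lam a b s t|) := fun t ht =>
    (hA₁.glue hA₂ hS ht).congr hS fun s _ _ => by
      unfold weightedKernel
      split_ifs <;> rfl
  have hk : ∀ t ∈ T ∩ Icc a b, deltaIntegral T a b (fun s => |weightedKernel w ψ lam a b s t|) =
      A₁ t - A₁ a + (A₂ b - A₂ t) := fun t ht =>
    ((hK t ht).deltaIntegral_eq hS).trans (hS.glue_increment A₁ A₂ ht)
  have hkc : ContinuousOn (fun t => A₁ t - A₁ a + (A₂ b - A₂ t)) (T ∩ Icc a b) :=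
    (hA₁.1.sub continuousOn_const).add (continuousOn_const.sub hA₂.1)
  obtain ⟨R, hR⟩ := hS.exists_preAntideriv_of_continuousOn
    (f := fun t => (P * |q t| + Q * |p t|) * (A₁ t - A₁ a + (A₂ b - A₂ t)))
    (((hqc.abs.const_mul P).add (hpc.abs.const_mul Q)).mul hkc)
  have hR' : IsDeltaPreAntideriv (T ∩ Icc a b) R (fun t => (P * |q t| + Q * |p t|) *
      deltaIntegral T a b (fun s => |weightedKernel w ψ lam a b s t|)) :=
    hR.congr hS fun t ht _ => by rw [hk t ht]
  have hqN := (hIq.const_mul hS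
    (deltaIntegral T a b (fun s => ν s * p (forwardJump T s)))).congr hS
    (fun t _ _ => mul_comm _ (q t))
  have hpN := (hIp.const_mul hS
    (deltaIntegral T a b (fun s => ν s * q (forwardJump T s)))).congr hS
    (fun t _ _ => mul_comm _ (p t))
  refine ⟨⟨⟨_, hwν⟩, ⟨_, hIp⟩, ⟨_, hIq⟩, ⟨_, hIpq⟩, ⟨_, hNp'⟩, ⟨_, hNq'⟩, ⟨_, hqN⟩, ⟨_, hpN⟩,
    fun t ht => ⟨_, hK t ht⟩, ⟨_, hR'⟩⟩, ?_⟩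
  rw [hqN.deltaIntegral_eq hS, hpN.deltaIntegral_eq hS, hNp'.deltaIntegral_eq hS,
    hNq'.deltaIntegral_eq hS, hR'.deltaIntegral_eq hS, hwν.deltaIntegral_eq hS,
    hIp.deltaIntegral_eq hS, hIq.deltaIntegral_eq hS, hIpq.deltaIntegral_eq hS]
  -- The left-hand side is the increment of a pre-antiderivative of `q Jp + p Jq`, where `Jp` and
  -- `Jq` are the left-hand sides of the Montgomery identities for `p` and `q`.
  have hL := ((hIpq.const_mul hS (2 * (c₂ - c₁))).add
    ((hIq.const_mul hS ((c₁ - w a) * p a + (w b - c₂) * p b - (Np b - Np a))).add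
      (hIp.const_mul hS ((c₁ - w a) * q a + (w b - c₂) * q b - (Nq b - Nq a))) hS) hS)
  have h := hL.abs_increment_le hR hS fun t ht _ => by
    have h1 := hS.montgomery_le hwν hpd hNp hA₁ hA₂ hP' ht
    have h2 := hS.montgomery_le hwν hqd hNq hA₁ hA₂ hQ' ht
    calc _ = |q t * ((c₂ - c₁) * p t + (c₁ - w a) * p a + (w b - c₂) * p b - (Np b - Np a))
          + p t * ((c₂ - c₁) * q t + (c₁ - w a) * q a + (w b - c₂) * q b - (Nq b - Nq a))| := by
          congr 1; ring
      _ ≤ |q t| * (P * (A₁ t - A₁ a + (A₂ b - A₂ t)))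
          + |p t| * (Q * (A₁ t - A₁ a + (A₂ b - A₂ t))) := by
          refine (abs_add_le _ _).trans ?_
          rw [abs_mul, abs_mul]
          gcongr
      _ = _ := by ring
  convert h using 2
  rw [hc₁, hc₂]
  ring
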